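/- Fix real constants $\lambda^*>0$, $\gamma>0$ and $\kappa<1$. Then there is a constant $\gamma'$, depending only on $\lambda^*,\gamma,\kappa$ (in particular independent of $d$, of the time horizon, of the arrival rate and of the service-time distribution), such that the following holds. Consider an $M_t/GI/1$ queue: customers arrive according to a Poisson process on $[0,\infty)$ with a positive continuous time-varying rate $\lambda_s\le\lambda^*$, with finitely many arrivals in every bounded time interval; service times are nonnegative, i.i.d. and independent of the arrival times; a single server serves the customers in order of arrival; the system is empty at time $0$. The residual work $W_s$ is the sum, over the customers present at time $s$, of their remaining service times (service time minus the length of time for which the customer has already been served). Let $\theta\ge 0$ be such that $d=\lceil\lambda^*\theta\rceil\ge 2$. For $0\le i\le d-1$ let $Y_i$ be the finite sequence of arrival and service times of the customers that arrive in $(i\theta/d,(i+1)\theta/d]$, put $U_j=Y_{d-j}$ for $1\le j\le d$, and let $$C(i)=\operatorname{Var}\bigl(E(W_\theta\mid U_{i+1},\dots,U_d)\bigr),\qquad 0\le i\le d-1 .$$ For $0\le s\le\theta$ let $Z_\theta(s)$ be the cumulative service time of the customers that arrive in $[s,\theta]$. Assume that, for all $0\le s\le s'\le\theta$ with $s'-s\le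 1/\lambda^*$, $$E\bigl(e^{\gamma(Z_\theta(s)-Z_\theta(s')-1/\lambda^*)}\bigr)\le\kappa ,$$ where $Z_\theta(s)-Z_\theta(s')$ is the total service time of the customers that arrive in $[s,s')$. Then $W_\theta$ is square-integrable and $$C(i)\le\gamma'\kappa^{i/2}\qquad\text{for } 0\le i\le d-1 .$$ -/

import Mathlib

open MeasureTheory ProbabilityTheory
open scoped NNReal

namespace TimeVaryingQueue

/-- `N` is (the counting process on `[0, ∞)` of) a Poisson process with time-varying rate `rate`:
`N t` is the number of arrivals in `(0, t]`. Its paths are nondecreasing, right-continuous,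
start at `0` and are finite everywhere; its increments are independent, and the number of arrivals
in `(s, t]` has the Poisson distribution with mean `∫ u in s..t, rate u`. -/
structure IsPoissonProcess {Ω : Type*} [MeasurableSpace Ω] (rate : ℝ → ℝ)
    (N : ℝ≥0 → Ω → ℕ) (P : Measure Ω) : Prop where
  measurable : ∀ t, Measurable (N t)
  zero : ∀ ω, N 0 ω = 0
  mono : ∀ ω, Monotone fun t => N t ω
  rightCont : ∀ ω t, ContinuousWithinAt (fun u => N u ω) (Set.Ici t) t
  indepIncrements : HasIndepIncrements N P
  law : ∀ s t : ℝ≥0, s ≤ t →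
    P.map (fun ω => N t ω - N s ω) = poissonMeasure (∫ u in (s : ℝ)..(t : ℝ), rate u).toNNReal

/-- The primitives of an `M_t/GI/1` queue: a Poisson arrival process `N` with time-varying rate, and
i.i.d. nonnegative service times, independent of the arrivals; `S k` is the service time of the
`k`-th customer to arrive, `k = 0, 1, 2, …`. -/
structure IsMtGI1 {Ω : Type*} [MeasurableSpace Ω] (rate : ℝ → ℝ)
    (N : ℝ≥0 → Ω → ℕ) (S : ℕ → Ω → ℝ) (P : Measure Ω) : Prop where
  arrivals : IsPoissonProcess rate N P
  service_measurable : ∀ k, Measurable (S k)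
  service_nonneg : ∀ k ω, 0 ≤ S k ω
  service_indep : iIndepFun S P
  service_identDistrib : ∀ k, IdentDistrib (S k) (S 0) P P
  service_indep_arrivals : IndepFun (fun ω k => S k ω) (fun ω t => N t ω) P

section Paths

/-! Functionals of one sample path: `n t` is the number of arrivals in `(0, t]`, and `σ k` is the
service time of customer `k`. -/

/-- Arrival time of customer `k` (meaningful when `k < n t` for some `t`, and only used then). -/
noncomputable def arrivalTime (n : ℝ≥0 → ℕ) (k : ℕ) : ℝ≥0 := sInf {t | k < n t}

/-- Time at which the service of customer `k` starts: there is a single server, which serves the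
customers in order of arrival, and the system is empty at time `0`. -/
noncomputable def startTime (n : ℝ≥0 → ℕ) (σ : ℕ → ℝ) : ℕ → ℝ
  | 0 => arrivalTime n 0
  | k + 1 => max (arrivalTime n (k + 1) : ℝ) (startTime n σ k + σ k)

/-- Remaining service time at time `s` of customer `k`, arrived by time `s`: its service time minus
the length `(s - startTime)⁺` of the period for which it has been served, and `0` once it has left
the system. -/
noncomputable def remainingService (n : ℝ≥0 → ℕ) (σ : ℕ → ℝ) (s : ℝ≥0) (k : ℕ) : ℝ :=
  max (σ k - max ((s : ℝ) - startTime n σ k) 0) 0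

/-- Residual work `W_s`: the sum of the remaining service times of the customers present at time
`s` (those that have left contribute `0`). -/
noncomputable def residualWork (n : ℝ≥0 → ℕ) (σ : ℕ → ℝ) (s : ℝ≥0) : ℝ :=
  ∑ k ∈ Finset.range (n s), remainingService n σ s k

/-- `Z_θ(s)`: cumulative service time of the customers that arrive in `[s, θ]`. -/
noncomputable def cumulativeService (n : ℝ≥0 → ℕ) (σ : ℕ → ℝ) (θ s : ℝ≥0) : ℝ :=
  ∑ k ∈ Finset.range (n θ), if s ≤ arrivalTime n k then σ k else 0

/-- The finitely supported sequence of the (arrival time, service time) pairs of the customers that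
arrive in `(a, b]`, in order of arrival, padded with `(0, 0)`. -/
noncomputable def arrivalData (n : ℝ≥0 → ℕ) (σ : ℕ → ℝ) (a b : ℝ≥0) (m : ℕ) : ℝ × ℝ :=
  if n a + m < n b then ((arrivalTime n (n a + m) : ℝ), σ (n a + m)) else (0, 0)

end Paths

/-- `C(i) = Var(E(V | U_{i+1}, …, U_d))`, for a real random variable `V = f(U_1, …, U_d)`. -/
noncomputable def capturedVariance {Ω F : Type*} [MeasurableSpace Ω] [MeasurableSpace F]
    (P : Measure Ω) (U : ℕ → Ω → F) (V : Ω → ℝ) (d i : ℕ) : ℝ :=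
  Var[P[V | ⨆ j ∈ Finset.Ioc i d, MeasurableSpace.comap (U j) inferInstance]; P]

/-- The driving variable `Y_i`, `0 ≤ i ≤ d - 1`: arrival and service times of the customers that
arrive in `(iθ/d, (i+1)θ/d]`. -/
noncomputable def drivingData {Ω : Type*} (N : ℝ≥0 → Ω → ℕ) (S : ℕ → Ω → ℝ) (θ : ℝ≥0) (d i : ℕ)
    (ω : Ω) : ℕ → ℝ × ℝ :=
  arrivalData (fun t => N t ω) (fun k => S k ω) (i * θ / d) ((i + 1) * θ / d)

/-- The `C(i)` of the queue: the target is `f(U) = W_θ`, with the time-reversed driving variables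
`U_j = Y_{d-j}`, `1 ≤ j ≤ d`. -/
noncomputable def queueC {Ω : Type*} [MeasurableSpace Ω] (P : Measure Ω)
    (N : ℝ≥0 → Ω → ℕ) (S : ℕ → Ω → ℝ) (θ : ℝ≥0) (d i : ℕ) : ℝ :=
  capturedVariance P (fun j => drivingData N S θ d (d - j))
    (fun ω => residualWork (fun t => N t ω) (fun k => S k ω) θ) d i

end TimeVaryingQueue

/-!
Write `λ*` for `rateMax` and `T_j` for the arrival time of customer `j`. For
first-come-first-served service the remaining service times telescope, and the residual work
satisfies the reflection formula (`residualWork_eq_sup`)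
`W_θ = max (0, max_{j < N_θ} (T_j + ∑_{j ≤ k < N_θ} S_k - θ))`.
Put `t = (d - i) θ / d`, so that `U_{i+1}, …, U_d` are the data of the customers arriving up to `t`.
Splitting the maximum at `j = N_t` gives `W_θ = max (R, W')`, where `W'`, the residual work at `θ` of
a system that is empty at `t`, depends only on the input after `t`. History and future of the input
are independent (`IsMtGI1.indepFun_past_future`), hence `E(W' | U_{i+1}, …, U_d)` is constant
and `C(i) ≤ E (W_θ - W') ^ 2 ≤ E R ^ 2` (`variance_condExp_le_integral`).

If customer `j < N_t` arrives in the interval `l < d - i`, the corresponding term of `R` is at most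
the work `A_l` brought in by the intervals `l, …, d - 1`, minus `(d - l - 1) θ / d`. With
`x ^ 2 ≤ 2 γ⁻² e^{γ x}` for `x ≥ 0` this bounds `R ^ 2` by a sum over `l < d - i` of exponentials
(`sup_excess_sq_le`). The exponential moments of the intervals multiply
(`IsMtGI1.integral_exp_sum_service_le`), so that the `l`-th term has mean at most
`κ ^ (d - l) e^{2 γ / λ*}` up to the factor `2 γ⁻²`, and the geometric sum is of order `κ ^ i`
(`IsMtGI1.integral_sum_exp_le`), which is better than the required `κ ^ (i / 2)`. The case `i = 0`
also gives the square-integrability of `W_θ`.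
-/

namespace TimeVaryingQueue

/-! ### Independence of history and future -/

/-- Two independent pairs `(X, Y)` and `(Z, W)`, each with independent entries, can be regrouped. -/
lemma indepFun_prodMk_prodMk_of_indepFun {Ω α β γ δ : Type*} [MeasurableSpace Ω]
    [MeasurableSpace α] [MeasurableSpace β] [MeasurableSpace γ] [MeasurableSpace δ]
    {P : Measure Ω} [IsProbabilityMeasure P] {X : Ω → α} {Y : Ω → β} {Z : Ω → γ} {W : Ω → δ}
    (hX : Measurable X) (hY : Measurable Y) (hZ : Measurable Z) (hW : Measurable W)
    (hXY : IndepFun X Y P) (hZW : IndepFun Z W P)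
    (h : IndepFun (fun ω => (X ω, Y ω)) (fun ω => (Z ω, W ω)) P) :
    IndepFun (fun ω => (X ω, Z ω)) (fun ω => (Y ω, W ω)) P := by
  have hXZ : IndepFun X Z P := h.comp measurable_fst measurable_fst
  have hYW : IndepFun Y W P := h.comp measurable_snd measurable_snd
  rw [IndepFun_iff_Indep]
  refine IndepSets.indep (hX.prodMk hZ).comap_le (hY.prodMk hW).comap_le
    (isPiSystem_prod.comap _) (isPiSystem_prod.comap _)
    (by rw [← generateFrom_prod, MeasurableSpace.comap_generateFrom]; rfl)
    (by rw [← generateFrom_prod, MeasurableSpace.comap_generateFrom]; rfl) ?_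
  rw [IndepSets_iff]
  rintro _ _ ⟨_, ⟨A, hA, B, hB, rfl⟩, rfl⟩ ⟨_, ⟨C, hC, D, hD, rfl⟩, rfl⟩
  have e1 := hXZ.measure_inter_preimage_eq_mul _ _ hA hB
  have e2 := hYW.measure_inter_preimage_eq_mul _ _ hC hD
  have e3 := h.measure_inter_preimage_eq_mul _ _ (hA.prod hC) (hB.prod hD)
  have e4 := hXY.measure_inter_preimage_eq_mul _ _ hA hC
  have e5 := hZW.measure_inter_preimage_eq_mul _ _ hB hD
  have f1 : (fun ω => (X ω, Z ω)) ⁻¹' (A ×ˢ B) = X ⁻¹' A ∩ Z ⁻¹' B := rfl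
  have f2 : (fun ω => (Y ω, W ω)) ⁻¹' (C ×ˢ D) = Y ⁻¹' C ∩ W ⁻¹' D := rfl
  have f3 : (fun ω => (X ω, Y ω)) ⁻¹' (A ×ˢ C) = X ⁻¹' A ∩ Y ⁻¹' C := rfl
  have f4 : (fun ω => (Z ω, W ω)) ⁻¹' (B ×ˢ D) = Z ⁻¹' B ∩ W ⁻¹' D := rfl
  rw [f3, f4, e4, e5] at e3
  rw [f1, f2, e1, e2, Set.inter_inter_inter_comm, e3]
  ring

/-- A finite set of times containing `0` is enumerated by a monotone sequence starting at `0`. -/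
lemma exists_monotone_enumeration (K : Finset ℝ≥0) (h0 : 0 ∈ K) :
    ∃ τ : ℕ → ℝ≥0, Monotone τ ∧ τ 0 = 0 ∧ ∀ u ∈ K, ∃ i, τ i = u := by
  have hc : 0 < K.card := Finset.card_pos.2 ⟨0, h0⟩
  let τ : ℕ → ℝ≥0 := fun i => K.orderEmbOfFin rfl ⟨min i (K.card - 1), by omega⟩
  have hτ : ∀ u ∈ K, ∃ i, τ i = u := by
    intro u hu
    have : u ∈ Set.range (K.orderEmbOfFin rfl) := by simpa using hu
    obtain ⟨i, rfl⟩ := this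
    refine ⟨i, ?_⟩
    simp only [τ]
    congr 1
    ext
    simp
    omega
  have hm : Monotone τ := by
    intro i j hij
    apply (K.orderEmbOfFin rfl).monotone
    simp only [Fin.mk_le_mk]
    omega
  refine ⟨τ, hm, ?_, hτ⟩
  obtain ⟨i, hi⟩ := hτ 0 h0
  exact le_antisymm (hi ▸ hm (Nat.zero_le i)) zero_le

section Independence

variable {Ω : Type*} [MeasurableSpace Ω] {P : Measure Ω}
  {rate : ℝ → ℝ} {N : ℝ≥0 → Ω → ℕ} {S : ℕ → Ω → ℝ}

/-- The arrivals up to time `t` are independent, as a process, of the increments after `t`. -/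
lemma IsPoissonProcess.indepFun_past_increments [IsProbabilityMeasure P]
    (hN : IsPoissonProcess rate N P) (t : ℝ≥0) :
    IndepFun (fun ω u => N (min u t) ω) (fun ω u => N u ω - N t ω) P := by
  refine IndepFun.process_indepFun_process (X := fun u ω => N (min u t) ω)
    (Y := fun u ω => N u ω - N t ω) (fun u => hN.measurable _)
    (fun u => (hN.measurable u).sub (hN.measurable t)) fun I J => ?_
  obtain ⟨τ, hτ, hτ0, hK⟩ := exists_monotone_enumeration
    ({0, t} ∪ (I.image (min · t) ∪ J.image (max · t))) (by simp)
  obtain ⟨r, hr⟩ := hK t (by simp)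
  set X : ℕ → Ω → ℕ := fun i ω => N (τ (i + 1)) ω - N (τ i) ω with hX
  have hXm : ∀ i, Measurable (X i) := fun i => (hN.measurable _).sub (hN.measurable _)
  have hind : iIndepFun X P := hN.indepIncrements.nat hτ
  have hsum : ∀ i j, i ≤ j → ∀ ω, ∑ l ∈ Finset.Ico i j, X l ω = N (τ j) ω - N (τ i) ω := by
    intro i j hij ω
    induction j, hij using Nat.le_induction with
    | base => simp
    | succ j hij ih =>
      rw [Finset.sum_Ico_succ_top hij, ih]
      have h1 := hN.mono ω (hτ hij)
      have h2 := hN.mono ω (hτ (Nat.le_succ j))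
      simp only [Nat.succ_eq_add_one, hX] at *
      omega
  have key := indep_iSup_of_disjoint (m := fun i => MeasurableSpace.comap (X i) inferInstance)
    (fun i => (hXm i).comap_le) hind.iIndep
    (S := Set.Iio r) (T := Set.Ici r) (by
      rw [Set.disjoint_left]; intro a ha hb; simp at ha hb; omega)
  have hmeas : ∀ (A : Set ℕ), ∀ i ∈ A,
      Measurable[⨆ l ∈ A, MeasurableSpace.comap (X l) inferInstance] (X i) := fun A i hi =>
    Measurable.of_comap_le (le_iSup₂_of_le i hi le_rfl)
  rw [IndepFun_iff_Indep]
  refine indep_of_indep_of_le key ?_ ?_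
  · refine Measurable.comap_le ?_
    refine @measurable_pi_lambda _ _ _ (_) _ _ fun u => ?_
    obtain ⟨i, hi⟩ := hK (min u.1 t) (by
      simp only [Finset.mem_union, Finset.mem_image]; exact .inr (.inl ⟨u.1, u.2, rfl⟩))
    have : (fun ω => N (min u.1 t) ω) = fun ω => ∑ l ∈ Finset.Ico 0 (min i r), X l ω := by
      ext ω
      rw [hsum _ _ (Nat.zero_le _), hτ0, hN.zero, Nat.sub_zero, hτ.map_min, hi, hr]
      simp
    rw [this]
    refine Finset.measurable_fun_sum _ fun l hl => hmeas _ _ ?_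
    simp at hl ⊢; omega
  · refine Measurable.comap_le ?_
    refine @measurable_pi_lambda _ _ _ (_) _ _ fun u => ?_
    obtain ⟨i, hi⟩ := hK (max u.1 t) (by
      simp only [Finset.mem_union, Finset.mem_image]; exact .inr (.inr ⟨u.1, u.2, rfl⟩))
    have : (fun ω => N u.1 ω - N t ω) = fun ω => ∑ l ∈ Finset.Ico r (max i r), X l ω := by
      ext ω
      rw [hsum _ _ (le_max_right _ _), hτ.map_max, hi, hr]
      rcases le_total u.1 t with h | h
      · have := hN.mono ω h
        simp only at this
        simp [h, this]
      · simp [h]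
    rw [this]
    refine Finset.measurable_fun_sum _ fun l hl => hmeas _ _ ?_
    simp at hl ⊢; omega

/-- The history of the queue up to time `t`: the arrivals up to `t` and the service times of the
customers that have arrived by `t` (`0` for later customers). -/
def pastData (N : ℝ≥0 → Ω → ℕ) (S : ℕ → Ω → ℝ) (t : ℝ≥0) (ω : Ω) : (ℝ≥0 → ℕ) × (ℕ → ℝ) :=
  (fun u => N (min u t) ω, fun k => if k < N t ω then S k ω else 0)

/-- The evolution of the queue's input after time `t`: the number of arrivals in `(t, u]`, and the
service times of the customers arriving after `t`, renumbered from `0`. -/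
def futureData (N : ℝ≥0 → Ω → ℕ) (S : ℕ → Ω → ℝ) (t : ℝ≥0) (ω : Ω) : (ℝ≥0 → ℕ) × (ℕ → ℝ) :=
  (fun u => N u ω - N t ω, fun m => S (N t ω + m) ω)

/-- A countable family of measurable functions, indexed by a measurable random index. -/
lemma measurable_comp_natIndex {Ω β : Type*} {m : MeasurableSpace Ω} [MeasurableSpace β]
    {f : ℕ → Ω → β} {K : Ω → ℕ} (hf : ∀ k, Measurable (f k)) (hK : Measurable K) :
    Measurable fun ω => f (K ω) ω :=
  (measurable_from_prod_countable_right (f := fun p : ℕ × Ω => f p.1 p.2) hf).comp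
    (hK.prodMk measurable_id)

lemma IsMtGI1.measurable_pastData (h : IsMtGI1 rate N S P) (t : ℝ≥0) :
    Measurable (pastData N S t) := by
  refine Measurable.prodMk (measurable_pi_lambda _ fun _ => h.arrivals.measurable _)
    (measurable_pi_lambda _ fun k => Measurable.ite ?_ (h.service_measurable k) measurable_const)
  exact (h.arrivals.measurable t) (measurableSet_Ioi (a := k))

lemma IsMtGI1.measurable_futureData (h : IsMtGI1 rate N S P) (t : ℝ≥0) :
    Measurable (futureData N S t) :=
  Measurable.prodMk
    (measurable_pi_lambda _ fun _ => (h.arrivals.measurable _).sub (h.arrivals.measurable t))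
    (measurable_pi_lambda _ fun m => measurable_comp_natIndex (f := fun k => S (k + m))
      (fun k => h.service_measurable (k + m)) (h.arrivals.measurable t))

/-- The first `k` service times are independent of the remaining ones. -/
lemma IsMtGI1.indepFun_truncate_shift [IsProbabilityMeasure P] (h : IsMtGI1 rate N S P) (k : ℕ) :
    IndepFun (fun ω j => if j < k then S j ω else 0) (fun ω j => S (k + j) ω) P := by
  have key := indep_iSup_of_disjoint (m := fun i => MeasurableSpace.comap (S i) inferInstance)
    (fun i => (h.service_measurable i).comap_le) h.service_indep.iIndep
    (S := Set.Iio k) (T := Set.Ici k) (by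
      rw [Set.disjoint_left]; intro a ha hb; simp at ha hb; omega)
  have hmeas : ∀ (A : Set ℕ), ∀ i ∈ A,
      Measurable[⨆ l ∈ A, MeasurableSpace.comap (S l) inferInstance] (S i) := fun A i hi =>
    Measurable.of_comap_le (le_iSup₂_of_le i hi le_rfl)
  rw [IndepFun_iff_Indep]
  refine indep_of_indep_of_le key ?_ ?_
  · refine Measurable.comap_le ?_
    refine @measurable_pi_lambda _ _ _ (_) _ _ fun j => ?_
    by_cases hj : j < k
    · simpa [hj] using hmeas (Set.Iio k) j hj
    · simp [hj]
  · refine Measurable.comap_le ?_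
    refine @measurable_pi_lambda _ _ _ (_) _ _ fun j => hmeas _ _ ?_
    simp

lemma IsMtGI1.identDistrib_shift [IsProbabilityMeasure P] (h : IsMtGI1 rate N S P) (k : ℕ) :
    IdentDistrib (fun ω j => S (k + j) ω) (fun ω j => S j ω) P P :=
  IdentDistrib.pi (fun j => (h.service_identDistrib (k + j)).trans
    (h.service_identDistrib j).symm)
    (h.service_indep.precomp (add_right_injective k)) h.service_indep

/-- History and future are independent. Conditionally on `N t = k` the history is built from the
arrivals before `t` and `S 0, …, S (k - 1)`, the future from the increments after `t` and
`S k, S (k + 1), …`; these are independent and the law of the latter does not depend on `k`. -/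
lemma IsMtGI1.indepFun_past_future [IsProbabilityMeasure P] (h : IsMtGI1 rate N S P) (t : ℝ≥0) :
    IndepFun (pastData N S t) (futureData N S t) P := by
  let ξ : Ω → ℝ≥0 → ℕ := fun ω u => N (min u t) ω
  let η : Ω → ℝ≥0 → ℕ := fun ω u => N u ω - N t ω
  let p : ℕ → Ω → (ℝ≥0 → ℕ) × (ℕ → ℝ) := fun k ω => (ξ ω, fun j => if j < k then S j ω else 0)
  let f : ℕ → Ω → (ℝ≥0 → ℕ) × (ℕ → ℝ) := fun k ω => (η ω, fun j => S (k + j) ω)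
  have hξ : Measurable ξ := measurable_pi_lambda _ fun u => h.arrivals.measurable _
  have hη : Measurable η := measurable_pi_lambda _ fun u =>
    (h.arrivals.measurable u).sub (h.arrivals.measurable t)
  have htr : ∀ k, Measurable fun ω j => if j < k then S j ω else 0 := fun k =>
    measurable_pi_lambda _ fun j => by
      by_cases hj : j < k <;> simp [hj, h.service_measurable]
  have hsh : ∀ k, Measurable fun ω j => S (k + j) ω := fun k =>
    measurable_pi_lambda _ fun j => h.service_measurable _
  have hSN : IndepFun (fun ω t => N t ω) (fun ω k => S k ω) P := h.service_indep_arrivals.symm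
  -- the deterministic maps that turn a full sample path into its pieces
  have mξη : Measurable fun n : ℝ≥0 → ℕ => ((fun u => n (min u t), fun u => n u - n t) :
      (ℝ≥0 → ℕ) × (ℝ≥0 → ℕ)) := by
    refine Measurable.prodMk ?_ ?_ <;> refine measurable_pi_lambda _ fun u => ?_
    · exact measurable_pi_apply _
    · exact (measurable_pi_apply _).sub (measurable_pi_apply _)
  have msh : ∀ k, Measurable fun σ : ℕ → ℝ => fun j => σ (k + j) := fun k =>
    measurable_pi_lambda _ fun j => measurable_pi_apply _
  have mtr : ∀ k, Measurable fun σ : ℕ → ℝ => fun j => if j < k then σ j else 0 := fun k =>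
    measurable_pi_lambda _ fun j => by
      by_cases hj : j < k <;> simp [hj, measurable_pi_apply]
  have hpf : ∀ k, IndepFun (p k) (f k) P := fun k =>
    indepFun_prodMk_prodMk_of_indepFun hξ hη (htr k) (hsh k)
      (h.arrivals.indepFun_past_increments t) (h.indepFun_truncate_shift k)
      (hSN.comp mξη ((mtr k).prodMk (msh k)))
  have hlaw : ∀ k, P.map (f k) = P.map (f 0) := by
    intro k
    have hk : ∀ k, P.map (f k) = (P.map η).prod (P.map fun ω j => S (k + j) ω) := fun k =>
      (indepFun_iff_map_prod_eq_prod_map_map hη.aemeasurable (hsh k).aemeasurable).1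
        (hSN.comp (measurable_snd.comp mξη) (msh k))
    rw [hk, hk, (h.identDistrib_shift k).map_eq, (h.identDistrib_shift 0).map_eq]
  have hp : ∀ k, Measurable (p k) := fun k => hξ.prodMk (htr k)
  have hf : ∀ k, Measurable (f k) := fun k => hη.prodMk (hsh k)
  have key : ∀ A B, MeasurableSet A → MeasurableSet B →
      P (pastData N S t ⁻¹' A ∩ futureData N S t ⁻¹' B)
        = P (pastData N S t ⁻¹' A) * P (f 0 ⁻¹' B) := by
    intro A B hA hB
    have hNk : ∀ k, MeasurableSet (N t ⁻¹' {k}) := fun k =>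
      h.arrivals.measurable t (measurableSet_singleton k)
    have split : ∀ E : Set Ω, MeasurableSet E → P E = ∑' k, P (N t ⁻¹' {k} ∩ E) := by
      intro E hE
      rw [← measure_iUnion]
      · congr 1
        ext ω
        simp
      · intro i j hij
        rw [Function.onFun, Set.disjoint_left]
        rintro ω ⟨h1, _⟩ ⟨h2, _⟩
        exact hij (h1.symm.trans h2)
      · exact fun k => (hNk k).inter hE
    rw [split _ ((h.measurable_pastData t hA).inter (h.measurable_futureData t hB)),
      split _ (h.measurable_pastData t hA), ← ENNReal.tsum_mul_right]
    refine tsum_congr fun k => ?_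
    -- the event `N t = k` is part of the history
    have hC : MeasurableSet {x : (ℝ≥0 → ℕ) × (ℕ → ℝ) | x.1 t = k} :=
      (show Measurable fun x : (ℝ≥0 → ℕ) × (ℕ → ℝ) => x.1 t from
        (measurable_pi_apply t).comp measurable_fst) (measurableSet_singleton k)
    have e1 : N t ⁻¹' {k} ∩ (pastData N S t ⁻¹' A ∩ futureData N S t ⁻¹' B)
        = p k ⁻¹' ({x | x.1 t = k} ∩ A) ∩ f k ⁻¹' B := by
      ext ω
      simp only [Set.mem_inter_iff, Set.mem_preimage, Set.mem_singleton_iff, Set.mem_ofPred_eq,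
        p, f, ξ, η, pastData, futureData, min_self, and_assoc]
      refine and_congr_right fun hk => ?_
      rw [hk]
    have e2 : N t ⁻¹' {k} ∩ pastData N S t ⁻¹' A = p k ⁻¹' ({x | x.1 t = k} ∩ A) := by
      ext ω
      simp only [Set.mem_inter_iff, Set.mem_preimage, Set.mem_singleton_iff, Set.mem_ofPred_eq,
        p, ξ, pastData, min_self]
      refine and_congr_right fun hk => ?_
      rw [hk]
    rw [e1, e2, (hpf k).measure_inter_preimage_eq_mul _ _ (hC.inter hA) hB,
      ← Measure.map_apply (hf k) hB, hlaw k, Measure.map_apply (hf 0) hB]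
  rw [indepFun_iff_measure_inter_preimage_eq_mul]
  intro A B hA hB
  have hB' := key Set.univ B MeasurableSet.univ hB
  simp only [Set.preimage_univ, Set.univ_inter, measure_univ, one_mul] at hB'
  rw [key A B hA hB, hB']

end Independence

/-! ### Sample paths -/

section Paths

variable {n : ℝ≥0 → ℕ} {σ : ℕ → ℝ}

lemma arrivalTime_le_iff (hm : Monotone n)
    (hr : ∀ t, ContinuousWithinAt n (Set.Ici t) t) {k : ℕ} {b : ℝ≥0} (hk : k < n b) (u : ℝ≥0) :
    arrivalTime n k ≤ u ↔ k < n u := by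
  refine ⟨fun h => lt_of_lt_of_le ?_ (hm h), fun h => csInf_le (OrderBot.bddBelow _) h⟩
  have h1 := hr (arrivalTime n k)
  rw [ContinuousWithinAt, nhds_discrete, Filter.tendsto_pure] at h1
  obtain ⟨v, hv, hsub⟩ := (mem_nhdsGE_iff_exists_Ico_subset' (a := arrivalTime n k)
    (u' := arrivalTime n k + 1) (by simp)).1 h1
  obtain ⟨w, hw, hwv⟩ := exists_lt_of_csInf_lt ⟨b, hk⟩ (show sInf {t | k < n t} < v from hv)
  have h2 : n w = n (arrivalTime n k) :=
    hsub ⟨csInf_le (OrderBot.bddBelow _) hw, hwv⟩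
  rw [← h2]
  exact hw

/-- The positive part of the excess over the remaining time `θ - T_j`, `T_j` being the arrival time
of customer `j`, of the work brought in by the customers `j, j + 1, …` up to time `θ`. -/
noncomputable def excess (n : ℝ≥0 → ℕ) (σ : ℕ → ℝ) (θ : ℝ≥0) (j : ℕ) : ℝ≥0 :=
  ((arrivalTime n j : ℝ) + ∑ k ∈ Finset.Ico j (n θ), σ k - θ).toNNReal

/-- The departure time `startTime n σ k + σ k` is the largest of the times
`T_j + σ j + ⋯ + σ k`, `j ≤ k`. -/
lemma startTime_add_le_iff (k : ℕ) (c : ℝ) :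
    startTime n σ k + σ k ≤ c ↔
      ∀ j ≤ k, (arrivalTime n j : ℝ) + ∑ l ∈ Finset.Ico j (k + 1), σ l ≤ c := by
  induction k generalizing c with
  | zero => simp [startTime]
  | succ k ih =>
    have h1 : startTime n σ (k + 1) + σ (k + 1) ≤ c ↔
        (arrivalTime n (k + 1) : ℝ) + σ (k + 1) ≤ c ∧
          startTime n σ k + σ k ≤ c - σ (k + 1) := by
      rw [startTime, ← le_sub_iff_add_le, max_le_iff, le_sub_iff_add_le]
    rw [h1, ih]
    constructor
    · rintro ⟨h2, h3⟩ j hj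
      rcases Nat.le_succ_iff.1 hj with hj | rfl
      · rw [Finset.sum_Ico_succ_top (by omega)]
        linarith [h3 j hj]
      · simpa using h2
    · intro h2
      refine ⟨by simpa using h2 (k + 1) le_rfl, fun j hj => ?_⟩
      have := h2 j (by omega)
      rw [Finset.sum_Ico_succ_top (by omega)] at this
      linarith

/-- The remaining service times telescope: customer `k + 1` starts when both customer `k` has left
and customer `k + 1` has arrived. -/
lemma sum_remainingService (hσ : ∀ k, 0 ≤ σ k) {s : ℝ≥0} {k : ℕ}
    (hk : ∀ j ≤ k, arrivalTime n j ≤ s) :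
    ∑ l ∈ Finset.range (k + 1), remainingService n σ s l
      = max (s : ℝ) (startTime n σ k + σ k) - s := by
  have hrem : ∀ l, remainingService n σ s l
      = max (s : ℝ) (startTime n σ l + σ l) - max (s : ℝ) (startTime n σ l) := by
    intro l
    have := hσ l
    simp only [remainingService]
    rcases le_total (s : ℝ) (startTime n σ l) with h | h
    · rw [max_eq_right (by linarith : (s : ℝ) - startTime n σ l ≤ 0), max_eq_right h,
        max_eq_left (by linarith), max_eq_right (by linarith)]
      ring
    · rw [max_eq_left (by linarith : 0 ≤ (s : ℝ) - startTime n σ l), max_eq_left h,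
        ← max_sub_sub_right, sub_self, max_comm]
      congr 1
      ring
  induction k with
  | zero =>
    have : (arrivalTime n 0 : ℝ) ≤ s := hk 0 le_rfl
    simp [hrem, startTime, this]
  | succ k ih =>
    have : (arrivalTime n (k + 1) : ℝ) ≤ s := hk (k + 1) le_rfl
    rw [Finset.sum_range_succ, ih fun j hj => hk j (by omega), hrem]
    have h2 : max (s : ℝ) (startTime n σ (k + 1)) = max (s : ℝ) (startTime n σ k + σ k) := by
      rw [startTime, ← max_assoc, max_eq_left this]
    rw [h2]
    ring

/-- The reflection formula for the residual work. -/
lemma residualWork_eq_sup (hm : Monotone n)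
    (hr : ∀ t, ContinuousWithinAt n (Set.Ici t) t) (hσ : ∀ k, 0 ≤ σ k) (s : ℝ≥0) :
    residualWork n σ s = ((Finset.range (n s)).sup (excess n σ s) : ℝ≥0) := by
  rw [residualWork]
  rcases hn : n s with _ | k
  · simp
  rw [sum_remainingService hσ fun j hj =>
    (arrivalTime_le_iff hm hr (b := s) (by omega) s).2 (by omega)]
  refine eq_of_forall_ge_iff fun c => ?_
  rcases lt_or_ge c 0 with hc | hc
  · refine iff_of_false (fun h => ?_) fun h => ?_
    · linarith [le_max_left (s : ℝ) (startTime n σ k + σ k)]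
    · exact absurd (h.trans_lt hc) (not_lt.2 (NNReal.coe_nonneg _))
  lift c to ℝ≥0 using hc
  rw [NNReal.coe_le_coe, Finset.sup_le_iff, sub_le_iff_le_add, max_le_iff, startTime_add_le_iff]
  have : (s : ℝ) ≤ c + s := by simp
  simp only [this, true_and, Finset.mem_range, Nat.lt_succ_iff]
  refine forall₂_congr fun j _ => ?_
  rw [excess, Real.toNNReal_le_iff_le_coe, hn, sub_le_iff_le_add]

/-- The squared excess due to customers arriving before the grid point `g L` is dominated by
exponentials of the work brought in from one of the earlier grid points on. -/
lemma sup_excess_sq_le (hm : Monotone n)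
    (hr : ∀ t, ContinuousWithinAt n (Set.Ici t) t) (h0 : n 0 = 0) (hσ : ∀ k, 0 ≤ σ k)
    {γ : ℝ} (hγ : 0 < γ) {g : ℕ → ℝ≥0} (hg0 : g 0 = 0) (L : ℕ) (θ : ℝ≥0) :
    (((Finset.range (n (g L))).sup (excess n σ θ) : ℝ≥0) : ℝ) ^ 2 ≤
      2 / γ ^ 2 * ∑ l ∈ Finset.range L,
        Real.exp (γ * (g (l + 1) - θ + ∑ k ∈ Finset.Ico (n (g l)) (n θ), σ k)) := by
  have hsum : ∀ l ∈ Finset.range L, 0 ≤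
      Real.exp (γ * (g (l + 1) - θ + ∑ k ∈ Finset.Ico (n (g l)) (n θ), σ k)) :=
    fun l _ => (Real.exp_pos _).le
  have hrhs := Finset.sum_nonneg hsum
  rcases (Finset.range (n (g L))).eq_empty_or_nonempty with he | hne
  · rw [he]
    simpa using by positivity
  obtain ⟨j, hj, hjs⟩ := Finset.exists_mem_eq_sup _ hne (excess n σ θ)
  rw [hjs]
  rcases eq_or_ne (excess n σ θ j) 0 with hz | hz
  · rw [hz]
    simpa using by positivity
  rw [Finset.mem_range] at hj
  have hpos : 0 < (arrivalTime n j : ℝ) + ∑ k ∈ Finset.Ico j (n θ), σ k - θ :=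
    Real.toNNReal_pos.1 (pos_iff_ne_zero.2 hz)
  rw [excess, Real.coe_toNNReal _ hpos.le]
  set x := (arrivalTime n j : ℝ) + ∑ k ∈ Finset.Ico j (n θ), σ k - θ with hx
  -- the first grid point `g (l + 1)` by which customer `j` has arrived
  have hex : ∃ l, j < n (g l) := ⟨L, hj⟩
  obtain ⟨l, hl⟩ : ∃ l, Nat.find hex = l + 1 := by
    refine Nat.exists_eq_succ_of_ne_zero fun h => ?_
    have := Nat.find_spec hex
    rw [h, hg0, h0] at this
    omega
  have hl1 : j < n (g (l + 1)) := hl ▸ Nat.find_spec hex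
  have hl2 : n (g l) ≤ j := not_lt.1 (Nat.find_min hex (by omega))
  have hlL : l < L := by
    have := Nat.find_min' hex hj
    omega
  have hT : (arrivalTime n j : ℝ) ≤ g (l + 1) := (arrivalTime_le_iff hm hr hl1 _).2 hl1
  have hS : ∑ k ∈ Finset.Ico j (n θ), σ k ≤ ∑ k ∈ Finset.Ico (n (g l)) (n θ), σ k :=
    Finset.sum_le_sum_of_subset_of_nonneg (Finset.Ico_subset_Ico_left hl2) fun k _ _ => hσ k
  have h1 : x ^ 2 ≤ 2 / γ ^ 2 * Real.exp (γ * x) := by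
    have := Real.quadratic_le_exp_of_nonneg (mul_pos hγ hpos).le
    rw [div_mul_eq_mul_div, le_div_iff₀ (by positivity)]
    nlinarith [mul_pos hγ hpos]
  refine h1.trans (mul_le_mul_of_nonneg_left ?_ (by positivity))
  refine le_trans ?_ (Finset.single_le_sum hsum (Finset.mem_range.2 hlL))
  exact Real.exp_le_exp.2 (mul_le_mul_of_nonneg_left (by linarith) hγ.le)

/-- Without an arrival at time `s` exactly, the work brought in during `[s, θ]` is that of the
customers numbered `n s, …, n θ - 1`. -/
lemma cumulativeService_eq_sum (hm : Monotone n)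
    (hr : ∀ t, ContinuousWithinAt n (Set.Ici t) t) {θ s : ℝ≥0}
    (hjump : ∀ k < n θ, arrivalTime n k ≠ s) :
    cumulativeService n σ θ s = ∑ k ∈ Finset.Ico (n s) (n θ), σ k := by
  rw [cumulativeService, Finset.range_eq_Ico, ← Finset.sum_filter]
  refine Finset.sum_congr ?_ fun _ _ => rfl
  ext k
  simp only [Finset.mem_filter, Finset.mem_Ico, zero_le, true_and]
  constructor
  · rintro ⟨h1, h2⟩
    refine ⟨not_lt.1 fun h => ?_, h1⟩
    exact hjump k h1 (le_antisymm ((arrivalTime_le_iff hm hr h1 s).2 h) h2)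
  · rintro ⟨h1, h2⟩
    refine ⟨h2, le_of_not_ge fun h => ?_⟩
    exact absurd ((arrivalTime_le_iff hm hr h2 s).1 h) (not_lt.2 h1)

end Paths

/-! ### Measurability and absence of fixed arrival times -/

section Measurability

variable {Ω : Type*} {m : MeasurableSpace Ω} {N : ℝ≥0 → Ω → ℕ} {S : ℕ → Ω → ℝ}

lemma measurable_arrivalTime_ite (hm : ∀ ω, Monotone fun t => N t ω)
    (hr : ∀ ω t, ContinuousWithinAt (fun u => N u ω) (Set.Ici t) t) {c : Ω → ℕ} {b : ℝ≥0}
    (hE : ∀ u ≤ b, MeasurableSet {ω | c ω < N u ω}) :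
    Measurable fun ω => if c ω < N b ω then arrivalTime (fun t => N t ω) (c ω) else 0 := by
  refine measurable_of_Iic fun u => ?_
  have : (fun ω => if c ω < N b ω then arrivalTime (fun t => N t ω) (c ω) else 0) ⁻¹' Set.Iic u
      = {ω | c ω < N b ω}ᶜ ∪ {ω | c ω < N (min u b) ω} := by
    ext ω
    simp only [Set.mem_preimage, Set.mem_Iic, Set.mem_union, Set.mem_compl_iff,
      Set.mem_ofPred_eq]
    split_ifs with h
    · have hmin : N (min u b) ω = min (N u ω) (N b ω) := (hm ω).map_min
      rw [arrivalTime_le_iff (hm ω) (hr ω) h, hmin, lt_min_iff]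
      simp [h]
    · simp [h]
  rw [this]
  exact (hE b le_rfl).compl.union (hE _ (min_le_right _ _))

/-- The data of the customers arriving in `(a, b]`, `b ≤ t`, are measurable for any σ-algebra that
observes the arrivals up to `t` and the service times of the customers arriving by `t`. -/
lemma measurable_arrivalData (hm : ∀ ω, Monotone fun t => N t ω)
    (hr : ∀ ω t, ContinuousWithinAt (fun u => N u ω) (Set.Ici t) t) {t : ℝ≥0}
    (hN : ∀ u ≤ t, Measurable (N u)) (hS : ∀ k, Measurable fun ω => if k < N t ω then S k ω else 0)
    {a b : ℝ≥0} (hab : a ≤ b) (hbt : b ≤ t) :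
    Measurable fun ω => arrivalData (fun t => N t ω) (fun k => S k ω) a b := by
  have hNa := hN a (hab.trans hbt)
  refine measurable_pi_lambda _ fun l => ?_
  have hE : ∀ u ≤ b, MeasurableSet {ω | N a ω + l < N u ω} := fun u hu =>
    measurableSet_lt (hNa.add_const l) (hN u (hu.trans hbt))
  have hT := (measurable_arrivalTime_ite hm hr hE).coe_nnreal_real
  have hσ := measurable_comp_natIndex (f := fun k ω => if k < N t ω then S k ω else 0) hS
    (hNa.add_const l)
  have : (fun ω => arrivalData (fun t => N t ω) (fun k => S k ω) a b l) = fun ω =>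
      if N a ω + l < N b ω then
        (((if N a ω + l < N b ω then arrivalTime (fun t => N t ω) (N a ω + l) else 0 : ℝ≥0) : ℝ),
          if N a ω + l < N t ω then S (N a ω + l) ω else 0) else (0, 0) := by
    ext1 ω
    simp only [arrivalData]
    split_ifs with h1 h2
    · rfl
    · exact absurd (h1.trans_le (hm ω hbt)) h2
    · rfl
  rw [this]
  exact Measurable.ite (hE b le_rfl) (hT.prodMk hσ) measurable_const

/-- The work brought in during `(a, b]`, `b ≤ t`, is determined by the history up to `t`. -/
lemma measurable_sum_service_of_past (hm : ∀ ω, Monotone fun t => N t ω) {t : ℝ≥0}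
    (hN : ∀ u ≤ t, Measurable (N u)) (hS : ∀ k, Measurable fun ω => if k < N t ω then S k ω else 0)
    {a b : ℝ≥0} (hat : a ≤ t) (hbt : b ≤ t) :
    Measurable fun ω => ∑ k ∈ Finset.Ico (N a ω) (N b ω), S k ω := by
  have h1 : ∀ i j, Measurable fun ω =>
      ∑ k ∈ Finset.Ico i j, if k < N t ω then S k ω else 0 := fun i j =>
    Finset.measurable_fun_sum _ fun k _ => hS k
  have h2 : Measurable fun ω =>
      ∑ k ∈ Finset.Ico (N a ω) (N b ω), if k < N t ω then S k ω else 0 :=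
    measurable_comp_natIndex
      (f := fun i ω => ∑ k ∈ Finset.Ico i (N b ω), if k < N t ω then S k ω else 0)
      (fun i => measurable_comp_natIndex (h1 i) (hN b hbt)) (hN a hat)
  have h3 : (fun ω => ∑ k ∈ Finset.Ico (N a ω) (N b ω), S k ω) = fun ω =>
      ∑ k ∈ Finset.Ico (N a ω) (N b ω), if k < N t ω then S k ω else 0 := by
    ext1 ω
    refine Finset.sum_congr rfl fun k hk => ?_
    rw [if_pos ((Finset.mem_Ico.1 hk).2.trans_le (hm ω hbt))]
  rw [h3]
  exact h2

lemma sum_Ico_eq_sum_range_add (f : ℕ → ℝ) (a b : ℕ) (l : ℕ) :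
    ∑ k ∈ Finset.Ico (a + l) b, f k = ∑ k ∈ Finset.Ico l (b - a), f (a + k) := by
  rw [Finset.sum_Ico_eq_sum_range, Finset.sum_Ico_eq_sum_range, Nat.sub_add_eq]
  simp only [add_assoc]

/-- The work brought in during `(t, b]` is determined by the input after `t`. -/
lemma measurable_sum_service_of_future {t : ℝ≥0} (hN : ∀ u, Measurable fun ω => N u ω - N t ω)
    (hS : ∀ l, Measurable fun ω => S (N t ω + l) ω) (b : ℝ≥0) :
    Measurable fun ω => ∑ k ∈ Finset.Ico (N t ω) (N b ω), S k ω := by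
  have : (fun ω => ∑ k ∈ Finset.Ico (N t ω) (N b ω), S k ω)
      = fun ω => ∑ k ∈ Finset.Ico 0 (N b ω - N t ω), S (N t ω + k) ω := by
    ext1 ω
    exact sum_Ico_eq_sum_range_add (fun k => S k ω) _ _ 0
  rw [this]
  exact measurable_comp_natIndex
    (fun i => Finset.measurable_fun_sum (Finset.Ico 0 i) fun l _ => hS l) (hN b)

/-- The residual work at time `θ` of a system that is empty at time `t` is determined by the input
after `t`. -/
lemma measurable_sup_excess_of_future (hm : ∀ ω, Monotone fun t => N t ω)
    (hr : ∀ ω t, ContinuousWithinAt (fun u => N u ω) (Set.Ici t) t) {t : ℝ≥0}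
    (hN : ∀ u, Measurable fun ω => N u ω - N t ω)
    (hS : ∀ l, Measurable fun ω => S (N t ω + l) ω) (θ : ℝ≥0) :
    Measurable fun ω => (Finset.Ico (N t ω) (N θ ω)).sup
      (excess (fun t => N t ω) (fun k => S k ω) θ) := by
  have hE : ∀ l, ∀ u ≤ θ, MeasurableSet {ω | N t ω + l < N u ω} := by
    intro l u _
    have : {ω | N t ω + l < N u ω} = {ω | l < N u ω - N t ω} := by
      ext ω
      simp only [Set.mem_ofPred_eq]
      omega
    rw [this]
    exact measurableSet_lt measurable_const (hN u)
  have hT := fun l => (measurable_arrivalTime_ite hm hr (hE l)).coe_nnreal_real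
  have hsum : ∀ l, Measurable fun ω =>
      ∑ k ∈ Finset.Ico l (N θ ω - N t ω), S (N t ω + k) ω := fun l =>
    measurable_comp_natIndex (f := fun i ω => ∑ k ∈ Finset.Ico l i, S (N t ω + k) ω)
      (fun i => Finset.measurable_fun_sum _ fun k _ => hS k) (hN θ)
  let X : ℕ → Ω → ℝ≥0 := fun l ω =>
    (((if N t ω + l < N θ ω then arrivalTime (fun t => N t ω) (N t ω + l) else 0 : ℝ≥0) : ℝ)
      + ∑ k ∈ Finset.Ico l (N θ ω - N t ω), S (N t ω + k) ω - θ).toNNReal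
  have hX : ∀ l, Measurable (X l) := fun l =>
    (((hT l).add (hsum l)).sub_const _).real_toNNReal
  have : (fun ω => (Finset.Ico (N t ω) (N θ ω)).sup
      (excess (fun t => N t ω) (fun k => S k ω) θ))
      = fun ω => (Finset.range (N θ ω - N t ω)).sup fun l => X l ω := by
    ext1 ω
    have himg : Finset.Ico (N t ω) (N θ ω)
        = (Finset.range (N θ ω - N t ω)).image (N t ω + ·) := by
      rw [Finset.range_eq_Ico, Finset.image_add_left_Ico, add_zero]
      ext k
      simp only [Finset.mem_Ico]
      omega
    rw [himg, Finset.sup_image]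
    refine Finset.sup_congr rfl fun l hl => ?_
    have hl' : N t ω + l < N θ ω := by
      have := Finset.mem_range.1 hl
      omega
    simp only [X, Function.comp, excess, if_pos hl']
    rw [sum_Ico_eq_sum_range_add]
  rw [this]
  refine measurable_comp_natIndex (f := fun i ω => (Finset.range i).sup fun l => X l ω)
    (fun i => ?_) (hN θ)
  induction i with
  | zero => simp
  | succ i ih =>
    simp only [Finset.range_add_one, Finset.sup_insert]
    exact (hX i).sup ih

end Measurability

section Observables

variable {Ω : Type*} {N : ℝ≥0 → Ω → ℕ} {S : ℕ → Ω → ℝ}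

lemma measurable_count_of_pastData {t u : ℝ≥0} (hu : u ≤ t) :
    Measurable[MeasurableSpace.comap (pastData N S t) inferInstance] (N u) := by
  have h : N u = (fun x : (ℝ≥0 → ℕ) × (ℕ → ℝ) => x.1 u) ∘ pastData N S t := by
    ext ω
    simp [pastData, hu]
  have hm : Measurable fun x : (ℝ≥0 → ℕ) × (ℕ → ℝ) => x.1 u :=
    (measurable_pi_apply u).comp measurable_fst
  rw [h]
  exact hm.comp (comap_measurable _)

lemma measurable_service_of_pastData (t : ℝ≥0) (k : ℕ) :
    Measurable[MeasurableSpace.comap (pastData N S t) inferInstance]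
      fun ω => if k < N t ω then S k ω else 0 := by
  have hm : Measurable fun x : (ℝ≥0 → ℕ) × (ℕ → ℝ) => x.2 k :=
    (measurable_pi_apply k).comp measurable_snd
  exact hm.comp (comap_measurable (pastData N S t))

lemma measurable_count_of_futureData (t u : ℝ≥0) :
    Measurable[MeasurableSpace.comap (futureData N S t) inferInstance]
      fun ω => N u ω - N t ω := by
  have hm : Measurable fun x : (ℝ≥0 → ℕ) × (ℕ → ℝ) => x.1 u :=
    (measurable_pi_apply u).comp measurable_fst
  exact hm.comp (comap_measurable (futureData N S t))

lemma measurable_service_of_futureData (t : ℝ≥0) (l : ℕ) :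
    Measurable[MeasurableSpace.comap (futureData N S t) inferInstance]
      fun ω => S (N t ω + l) ω := by
  have hm : Measurable fun x : (ℝ≥0 → ℕ) × (ℕ → ℝ) => x.2 l :=
    (measurable_pi_apply l).comp measurable_snd
  exact hm.comp (comap_measurable (futureData N S t))

end Observables

section Law

variable {Ω : Type*} [MeasurableSpace Ω] {P : Measure Ω} {rate : ℝ → ℝ} {N : ℝ≥0 → Ω → ℕ}

/-- An arrival process with bounded rate has no arrival at a given time. -/
lemma IsPoissonProcess.ae_arrivalTime_ne (hN : IsPoissonProcess rate N P) {rateMax : ℝ}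
    (hrate : ∀ s : ℝ, 0 ≤ s → 0 < rate s ∧ rate s ≤ rateMax) (s : ℝ≥0) :
    ∀ᵐ ω ∂P, ∀ b k, k < N b ω → arrivalTime (fun t => N t ω) k ≠ s := by
  rw [ae_iff]
  set E : Set Ω := {ω | ¬ ∀ b k, k < N b ω → arrivalTime (fun t => N t ω) k ≠ s} with hE
  have hjump : ∀ ω ∈ E, ∀ v < s, N s ω - N v ω ≠ 0 := by
    intro ω hω v hv
    simp only [hE, Set.mem_ofPred_eq, not_forall, not_not] at hω
    obtain ⟨b, k, hk, hT⟩ := hω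
    have h1 := (arrivalTime_le_iff (hN.mono ω) (hN.rightCont ω) hk s).1 hT.le
    have h2 := mt (arrivalTime_le_iff (hN.mono ω) (hN.rightCont ω) hk v).2
      (not_le.2 (hT ▸ hv))
    omega
  rcases eq_or_ne s 0 with rfl | hs
  · have : E = ∅ := by
      ext ω
      simp only [hE, Set.mem_ofPred_eq, not_forall, not_not, Set.mem_empty_iff_false, iff_false]
      rintro ⟨b, k, hk, hT⟩
      have h1 := (arrivalTime_le_iff (hN.mono ω) (hN.rightCont ω) hk 0).1 hT.le
      simp [hN.zero] at h1
    rw [this, measure_empty]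
  have hbound : ∀ v < s, P E ≤ ENNReal.ofReal (rateMax * (s - v)) := by
    intro v hv
    set r := (∫ u in (v : ℝ)..(s : ℝ), rate u).toNNReal with hr
    have hlaw := hN.law v s hv.le
    have hmeas : Measurable fun ω => N s ω - N v ω := (hN.measurable s).sub (hN.measurable v)
    have h1 : P E ≤ poissonMeasure r {0}ᶜ := by
      rw [← hlaw, Measure.map_apply hmeas (measurableSet_singleton 0).compl]
      exact measure_mono fun ω hω => hjump ω hω v hv
    refine h1.trans ?_
    rw [prob_compl_eq_one_sub (measurableSet_singleton 0), poissonMeasure_singleton,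
      ← ENNReal.ofReal_one, ← ENNReal.ofReal_sub _ (by positivity)]
    refine ENNReal.ofReal_le_ofReal ?_
    have h2 : (r : ℝ) ≤ rateMax * (s - v) := by
      rw [hr, Real.coe_toNNReal']
      have hvs : (v : ℝ) ≤ s := hv.le
      have h0 : 0 < rateMax := (hrate 0 le_rfl).1.trans_le (hrate 0 le_rfl).2
      refine max_le ?_ (mul_nonneg h0.le (sub_nonneg.2 hvs))
      have := intervalIntegral.norm_integral_le_of_norm_le_const (a := (v : ℝ)) (b := s)
        (f := rate) (C := rateMax) fun x hx => by
          rw [Set.uIoc_of_le hvs] at hx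
          have hx0 := hrate x (v.2.trans hx.1.le)
          rw [Real.norm_of_nonneg hx0.1.le]
          exact hx0.2
      rw [abs_of_nonneg (sub_nonneg.2 hvs)] at this
      exact (le_abs_self _).trans this
    have h3 := Real.add_one_le_exp (-(r : ℝ))
    simp only [pow_zero, Nat.factorial_zero, Nat.cast_one, mul_one, div_one]
    linarith
  have hne : (nhdsWithin s (Set.Iio s)).NeBot :=
    nhdsLT_neBot_of_exists_lt ⟨0, pos_iff_ne_zero.2 hs⟩
  have hlim : Filter.Tendsto (fun v : ℝ≥0 => ENNReal.ofReal (rateMax * (s - v)))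
      (nhdsWithin s (Set.Iio s)) (nhds 0) := by
    have hc : Continuous fun v : ℝ≥0 => ENNReal.ofReal (rateMax * (s - v)) :=
      ENNReal.continuous_ofReal.comp (by fun_prop)
    have := (hc.tendsto s).mono_left (nhdsWithin_le_nhds (s := Set.Iio s))
    simpa using this
  exact le_antisymm (ge_of_tendsto hlim (Filter.eventually_of_mem self_mem_nhdsWithin hbound))
    zero_le

end Law

/-! ### Exponential moments and conditional variance -/

section Moments

variable {Ω : Type*} [mΩ : MeasurableSpace Ω] {P : Measure Ω}
  {rate : ℝ → ℝ} {N : ℝ≥0 → Ω → ℕ} {S : ℕ → Ω → ℝ}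

/-- If `(V - V') ^ 2 ≤ G` for a variable `V'` independent of `m`, conditioning `V` on `m` captures
at most the variance `E G`: the conditional expectation of `V'` is constant. -/
lemma variance_condExp_le_integral [IsProbabilityMeasure P] {m m' : MeasurableSpace Ω}
    (hm : m ≤ mΩ) (hm' : m' ≤ mΩ) {V V' G : Ω → ℝ} (hV : MemLp V 2 P) (hV' : MemLp V' 2 P)
    (hG : Integrable G P) (hmeas : StronglyMeasurable[m'] V') (hind : Indep m' m P)
    (hle : ∀ ω, (V ω - V' ω) ^ 2 ≤ G ω) : Var[P[V | m]; P] ≤ ∫ ω, G ω ∂P := by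
  have hD : MemLp (V - V') 2 P := hV.sub hV'
  have h1 : P[V | m] =ᵐ[P] fun ω => P[V'] + (P[V - V' | m]) ω := by
    have hadd := condExp_add (hV'.integrable one_le_two) (hD.integrable one_le_two) m
    have hc := condExp_indep_eq hm' hm hmeas hind
    rw [add_sub_cancel] at hadd
    filter_upwards [hadd, hc] with ω h1 h2
    rw [h1, Pi.add_apply, h2]
  have h2 := integral_condVar_add_variance_condExp hm hD
  have h3 : 0 ≤ ∫ ω, (Var[V - V'; P | m]) ω ∂P := by
    refine integral_nonneg_of_ae ?_
    exact condExp_nonneg (Filter.Eventually.of_forall fun ω => sq_nonneg _)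
  rw [variance_congr h1, variance_const_add integrable_condExp.aestronglyMeasurable]
  have h4 : Var[V - V'; P] ≤ P[(V - V') ^ 2] :=
    variance_le_expectation_sq hD.aestronglyMeasurable
  have h5 : P[(V - V') ^ 2] ≤ ∫ ω, G ω ∂P := integral_mono hD.integrable_sq hG hle
  linarith

/-- The exponential moments of the work brought in during successive intervals multiply. -/
lemma IsMtGI1.integral_exp_sum_service_le [IsProbabilityMeasure P] (h : IsMtGI1 rate N S P)
    {γ q : ℝ} (hq : 0 ≤ q) {g : ℕ → ℝ≥0} (hg : Monotone g) (d : ℕ)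
    (hblock : ∀ l < d,
      Integrable (fun ω => Real.exp (γ * ∑ k ∈ Finset.Ico (N (g l) ω) (N (g (l + 1)) ω), S k ω)) P ∧
      ∫ ω, Real.exp (γ * ∑ k ∈ Finset.Ico (N (g l) ω) (N (g (l + 1)) ω), S k ω) ∂P ≤ q)
    (p : ℕ) : ∀ l, l + p = d →
      Integrable (fun ω => Real.exp (γ * ∑ k ∈ Finset.Ico (N (g l) ω) (N (g d) ω), S k ω)) P ∧
      ∫ ω, Real.exp (γ * ∑ k ∈ Finset.Ico (N (g l) ω) (N (g d) ω), S k ω) ∂P ≤ q ^ p := by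
  induction p with
  | zero =>
    rintro l rfl
    simp
  | succ p ih =>
    intro l hl
    obtain ⟨i1, b1⟩ := hblock l (by omega)
    obtain ⟨i2, b2⟩ := ih (l + 1) (by omega)
    set t := g (l + 1)
    have hsplit : (fun ω => Real.exp (γ * ∑ k ∈ Finset.Ico (N (g l) ω) (N (g d) ω), S k ω))
        = fun ω => Real.exp (γ * ∑ k ∈ Finset.Ico (N (g l) ω) (N t ω), S k ω)
          * Real.exp (γ * ∑ k ∈ Finset.Ico (N t ω) (N (g d) ω), S k ω) := by
      ext1 ω
      rw [← Real.exp_add, ← mul_add, Finset.sum_Ico_consecutive _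
        (h.arrivals.mono ω (hg (Nat.le_succ l))) (h.arrivals.mono ω (hg (by omega)))]
    have hind : IndepFun (fun ω => Real.exp (γ * ∑ k ∈ Finset.Ico (N (g l) ω) (N t ω), S k ω))
        (fun ω => Real.exp (γ * ∑ k ∈ Finset.Ico (N t ω) (N (g d) ω), S k ω)) P := by
      rw [IndepFun_iff_Indep]
      refine indep_of_indep_of_le ((IndepFun_iff_Indep _ _ _).1 (h.indepFun_past_future t)) ?_ ?_
      · have := measurable_sum_service_of_past h.arrivals.mono
          (fun u hu => measurable_count_of_pastData (S := S) hu)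
          (measurable_service_of_pastData t) (hg (Nat.le_succ l)) (le_refl t)
        exact (Real.measurable_exp.comp (this.const_mul γ)).comap_le
      · have := measurable_sum_service_of_future
          (measurable_count_of_futureData (N := N) (S := S) t)
          (measurable_service_of_futureData t) (g d)
        exact (Real.measurable_exp.comp (this.const_mul γ)).comap_le
    rw [hsplit]
    refine ⟨hind.integrable_mul i1 i2, ?_⟩
    rw [hind.integral_fun_mul_eq_mul_integral i1.aestronglyMeasurable i2.aestronglyMeasurable,
      pow_succ']
    exact mul_le_mul b1 b2 (integral_nonneg fun ω => (Real.exp_pos _).le) hq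

lemma IsMtGI1.measurable_sup_excess_Ico (h : IsMtGI1 rate N S P) (t θ : ℝ≥0) :
    Measurable[MeasurableSpace.comap (futureData N S t) inferInstance] fun ω =>
      (Finset.Ico (N t ω) (N θ ω)).sup (excess (fun t => N t ω) (fun k => S k ω) θ) :=
  measurable_sup_excess_of_future h.arrivals.mono h.arrivals.rightCont
    (measurable_count_of_futureData (N := N) (S := S) t) (measurable_service_of_futureData t) θ

/-- The driving data of the intervals before `t` are part of the history up to `t`. -/
lemma IsMtGI1.comap_drivingData_le (h : IsMtGI1 rate N S P) (θ t : ℝ≥0) (d i : ℕ)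
    (ht : ((i : ℝ≥0) + 1) * θ / d ≤ t) :
    MeasurableSpace.comap (drivingData N S θ d i) inferInstance
      ≤ MeasurableSpace.comap (pastData N S t) inferInstance := by
  have := measurable_arrivalData h.arrivals.mono h.arrivals.rightCont
    (fun u hu => measurable_count_of_pastData (S := S) hu)
    (measurable_service_of_pastData t) (a := i * θ / d) (b := (i + 1) * θ / d)
    (by gcongr; simp) ht
  exact this.comap_le

/-- Among the `d = ⌈λ θ⌉` intervals of length `θ / d`, replacing `θ / d` by `1 / λ` costs at most
`1 / λ` in total, since `d / λ - θ ≤ 1 / λ`; one further interval is lost to the rounding of the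
arrival time. -/
lemma exponent_le {r θ : ℝ} (hr : 0 < r) {d l : ℕ} (hd : 0 < d)
    (hl : l ≤ d) (h1 : r * θ ≤ d) (h2 : (d : ℝ) < r * θ + 1) :
    ((l : ℝ) + 1) * θ / d - θ + (d - l : ℕ) * (1 / r) ≤ 2 / r := by
  have hd' : (0 : ℝ) < d := by exact_mod_cast hd
  have hl' : (l : ℝ) ≤ d := by exact_mod_cast hl
  rw [Nat.cast_sub hl]
  have e : ((l : ℝ) + 1) * θ / d - θ + (d - l) * (1 / r)
      = θ / d + (d - l) / d * (d / r - θ) := by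
    field_simp
    ring
  have a1 : θ / d ≤ 1 / r := by
    rw [div_le_div_iff₀ hd' hr]; linarith
  have a2 : (d : ℝ) / r - θ ≤ 1 / r := by
    rw [div_sub' hr.ne', div_le_div_iff_of_pos_right hr]; linarith
  have a3 : 0 ≤ (d : ℝ) / r - θ := by
    rw [sub_nonneg, le_div_iff₀ hr]; linarith
  have a4 : ((d : ℝ) - l) / d ≤ 1 := (div_le_one hd').2 (by linarith [Nat.cast_nonneg (α := ℝ) l])
  have a5 : (d - l) / d * (d / r - θ) ≤ 1 * (d / r - θ) :=
    mul_le_mul_of_nonneg_right a4 a3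
  have a6 : (2 : ℝ) / r = 1 / r + 1 / r := by ring
  rw [e]
  linarith

lemma sum_range_pow_sub_le {κ : ℝ} (h0 : 0 ≤ κ) (h1 : κ < 1) {d L : ℕ} (hL : L ≤ d) :
    ∑ l ∈ Finset.range L, κ ^ (d - l) ≤ κ ^ (d - L) / (1 - κ) := by
  have h2 : ∀ l ∈ Finset.range L, κ ^ (d - l) = κ ^ (d - L) * κ * κ ^ (L - 1 - l) := by
    intro l hl
    have := Finset.mem_range.1 hl
    rw [← pow_succ, ← pow_add]
    congr 1
    omega
  rw [Finset.sum_congr rfl h2, ← Finset.mul_sum, Finset.sum_range_reflect (fun l => κ ^ l) L,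
    mul_assoc, div_eq_mul_inv]
  refine mul_le_mul_of_nonneg_left ?_ (pow_nonneg h0 _)
  have h3 : ∑ l ∈ Finset.range L, κ ^ l ≤ (1 - κ)⁻¹ := by
    rw [← tsum_geometric_of_lt_one h0 h1]
    exact (summable_geometric_of_lt_one h0 h1).sum_le_tsum _ fun _ _ => pow_nonneg h0 _
  have h4 : 0 ≤ ∑ l ∈ Finset.range L, κ ^ l := Finset.sum_nonneg fun _ _ => pow_nonneg h0 _
  nlinarith

/-- The dominating variable of `sup_excess_sq_le`, summed over the grid points before `g L`, has
mean of order `κ ^ (d - L)`. -/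
lemma IsMtGI1.integral_sum_exp_le [IsProbabilityMeasure P] (h : IsMtGI1 rate N S P)
    {r γ κ : ℝ} (hr : 0 < r) (hγ : 0 < γ) (hκ0 : 0 < κ) (hκ : κ < 1) {θ : ℝ≥0} {d : ℕ}
    (hd0 : 0 < d) (h1 : r * θ ≤ d) (h2 : (d : ℝ) < r * θ + 1) {g : ℕ → ℝ≥0}
    (hg : ∀ l, g l = l * θ / d)
    (hblock : ∀ l < d,
      Integrable (fun ω => Real.exp (γ * ∑ k ∈ Finset.Ico (N (g l) ω) (N (g (l + 1)) ω), S k ω)) P ∧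
      ∫ ω, Real.exp (γ * ∑ k ∈ Finset.Ico (N (g l) ω) (N (g (l + 1)) ω), S k ω) ∂P
        ≤ κ * Real.exp (γ * (1 / r))) {L : ℕ} (hL : L ≤ d) :
    Integrable (fun ω => 2 / γ ^ 2 * ∑ l ∈ Finset.range L,
        Real.exp (γ * (g (l + 1) - θ + ∑ k ∈ Finset.Ico (N (g l) ω) (N θ ω), S k ω))) P ∧
      ∫ ω, 2 / γ ^ 2 * ∑ l ∈ Finset.range L,
        Real.exp (γ * (g (l + 1) - θ + ∑ k ∈ Finset.Ico (N (g l) ω) (N θ ω), S k ω)) ∂P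
      ≤ 2 / γ ^ 2 * Real.exp (γ * (2 / r)) / (1 - κ) * κ ^ (d - L) := by
  have hgm : Monotone g := fun a b hab => by
    rw [hg, hg]
    gcongr
  have hgd : g d = θ := by
    rw [hg]
    field_simp
  have hterm : ∀ l ∈ Finset.range L,
      Integrable (fun ω =>
        Real.exp (γ * (g (l + 1) - θ + ∑ k ∈ Finset.Ico (N (g l) ω) (N θ ω), S k ω))) P ∧
      ∫ ω, Real.exp (γ * (g (l + 1) - θ + ∑ k ∈ Finset.Ico (N (g l) ω) (N θ ω), S k ω)) ∂P
        ≤ Real.exp (γ * (2 / r)) * κ ^ (d - l) := by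
    intro l hl
    have hld : l < d := (Finset.mem_range.1 hl).trans_le hL
    obtain ⟨i1, b1⟩ := h.integral_exp_sum_service_le (by positivity) hgm d hblock (d - l) l
      (by omega)
    rw [hgd] at i1 b1
    simp_rw [mul_add γ, Real.exp_add]
    refine ⟨i1.const_mul _, ?_⟩
    rw [integral_const_mul]
    refine (mul_le_mul_of_nonneg_left b1 (Real.exp_pos _).le).trans ?_
    rw [mul_pow, ← Real.exp_nat_mul, mul_left_comm, ← Real.exp_add, mul_comm]
    refine mul_le_mul_of_nonneg_right (Real.exp_le_exp.2 ?_) (by positivity)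
    have := exponent_le hr hd0 hld.le h1 h2
    have hgl : (g (l + 1) : ℝ) = ((l : ℝ) + 1) * θ / d := by
      rw [hg]
      push_cast
      rfl
    rw [hgl]
    calc _ = γ * (((l : ℝ) + 1) * θ / d - θ + (d - l : ℕ) * (1 / r)) := by ring
      _ ≤ _ := mul_le_mul_of_nonneg_left this hγ.le
  refine ⟨(integrable_finsetSum _ fun l hl => (hterm l hl).1).const_mul _, ?_⟩
  rw [integral_const_mul, integral_finsetSum _ fun l hl => (hterm l hl).1]
  calc _ ≤ 2 / γ ^ 2 * ∑ l ∈ Finset.range L, Real.exp (γ * (2 / r)) * κ ^ (d - l) := by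
        refine mul_le_mul_of_nonneg_left (Finset.sum_le_sum fun l hl => (hterm l hl).2) ?_
        positivity
    _ ≤ 2 / γ ^ 2 * (Real.exp (γ * (2 / r)) * (κ ^ (d - L) / (1 - κ))) := by
        rw [← Finset.mul_sum]
        have := sum_range_pow_sub_le hκ0.le hκ hL
        gcongr
    _ = _ := by ring

end Moments

end TimeVaryingQueue

theorem proposition4p4 (rateMax γ κ : ℝ) (hrateMax : 0 < rateMax) (hγ : 0 < γ) (hκ : κ < 1) :
    ∃ γ' : ℝ,
      ∀ (Ω : Type*) [MeasurableSpace Ω] (P : Measure Ω) [IsProbabilityMeasure P]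
        (rate : ℝ → ℝ) (N : ℝ≥0 → Ω → ℕ) (S : ℕ → Ω → ℝ) (θ : ℝ≥0) (d : ℕ),
        ContinuousOn rate (Set.Ici 0) →
        (∀ s : ℝ, 0 ≤ s → 0 < rate s ∧ rate s ≤ rateMax) →
        TimeVaryingQueue.IsMtGI1 rate N S P →
        d = ⌈rateMax * (θ : ℝ)⌉₊ →
        2 ≤ d →
        (∀ s s' : ℝ≥0, s ≤ s' → s' ≤ θ → (s' : ℝ) - s ≤ 1 / rateMax →
          let Z : ℝ≥0 → Ω → ℝ := fun u ω =>
            TimeVaryingQueue.cumulativeService (fun t => N t ω) (fun k => S k ω) θ u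
          Integrable (fun ω => Real.exp (γ * (Z s ω - Z s' ω - 1 / rateMax))) P ∧
            ∫ ω, Real.exp (γ * (Z s ω - Z s' ω - 1 / rateMax)) ∂P ≤ κ) →
        MemLp (fun ω => TimeVaryingQueue.residualWork (fun t => N t ω) (fun k => S k ω) θ) 2 P ∧
          ∀ i : ℕ, i ≤ d - 1 →
            TimeVaryingQueue.queueC P N S θ d i ≤ γ' * κ ^ ((i : ℝ) / 2) := by
  refine ⟨2 / γ ^ 2 * Real.exp (γ * (2 / rateMax)) / (1 - κ), ?_⟩
  intro Ω mΩ P _ rate N S θ d _ hrate h hd hd2 hZ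
  -- the case `s = s'` of the moment condition forces `κ > 0`
  have hκ0 : 0 < κ := by
    have := (hZ 0 0 le_rfl zero_le (by simp; positivity)).2
    simp only [sub_self, integral_const, probReal_univ, one_smul] at this
    exact (Real.exp_pos _).trans_le this
  have hd0 : 0 < d := by omega
  have h1 : rateMax * θ ≤ d := hd ▸ Nat.le_ceil _
  have h2 : (d : ℝ) < rateMax * θ + 1 := hd ▸ Nat.ceil_lt_add_one (by positivity)
  set g : ℕ → ℝ≥0 := fun l => l * θ / d with hg
  have hgm : Monotone g := fun a b hab => by
    simp only [hg]
    gcongr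
  have hgd : g d = θ := by
    simp only [hg]
    field_simp
  have hg0 : g 0 = 0 := by simp [hg]
  have hm := h.arrivals.mono
  have hrc := h.arrivals.rightCont
  have hN0 := h.arrivals.zero
  have hS0 : ∀ ω k, 0 ≤ S k ω := fun ω k => h.service_nonneg k ω
  have hblock : ∀ l < d,
      Integrable (fun ω => Real.exp (γ * ∑ k ∈ Finset.Ico (N (g l) ω) (N (g (l + 1)) ω), S k ω)) P ∧
      ∫ ω, Real.exp (γ * ∑ k ∈ Finset.Ico (N (g l) ω) (N (g (l + 1)) ω), S k ω) ∂P
        ≤ κ * Real.exp (γ * (1 / rateMax)) := by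
    intro l hl
    have hle : g (l + 1) ≤ θ := hgd ▸ hgm hl
    have hlen : (g (l + 1) : ℝ) - g l ≤ 1 / rateMax := by
      have hd' : (0 : ℝ) < d := by exact_mod_cast hd0
      have : (g (l + 1) : ℝ) - g l = θ / d := by
        simp only [hg]
        push_cast
        ring
      rw [this, div_le_div_iff₀ hd' hrateMax]
      linarith
    obtain ⟨i1, b1⟩ := hZ (g l) (g (l + 1)) (hgm (Nat.le_succ l)) hle hlen
    -- almost surely no customer arrives at an end point, so that `[s, s')` and `(s, s']` agree
    have hae : (fun ω => Real.exp (γ *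
        (TimeVaryingQueue.cumulativeService (fun t => N t ω) (fun k => S k ω) θ (g l)
          - TimeVaryingQueue.cumulativeService (fun t => N t ω) (fun k => S k ω) θ (g (l + 1))
          - 1 / rateMax)) * Real.exp (γ * (1 / rateMax))) =ᵐ[P]
        fun ω => Real.exp (γ * ∑ k ∈ Finset.Ico (N (g l) ω) (N (g (l + 1)) ω), S k ω) := by
      filter_upwards [h.arrivals.ae_arrivalTime_ne hrate (g l),
        h.arrivals.ae_arrivalTime_ne hrate (g (l + 1))] with ω e1 e2
      rw [TimeVaryingQueue.cumulativeService_eq_sum (hm ω) (hrc ω) (e1 θ),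
        TimeVaryingQueue.cumulativeService_eq_sum (hm ω) (hrc ω) (e2 θ),
        ← Finset.sum_Ico_consecutive _ (hm ω (hgm (Nat.le_succ l))) (hm ω hle), ← Real.exp_add]
      congr 1
      ring
    refine ⟨(i1.mul_const _).congr hae, ?_⟩
    rw [← integral_congr_ae hae, integral_mul_const]
    exact mul_le_mul_of_nonneg_right b1 (Real.exp_pos _).le
  have hG := fun {L : ℕ} (hL : L ≤ d) => h.integral_sum_exp_le hrateMax hγ hκ0 hκ hd0 h1 h2
    (fun _ => rfl) hblock hL
  have hW : ∀ ω, TimeVaryingQueue.residualWork (fun t => N t ω) (fun k => S k ω) θ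
      = ((Finset.range (N θ ω)).sup
          (TimeVaryingQueue.excess (fun t => N t ω) (fun k => S k ω) θ) : ℝ≥0) := fun ω =>
    TimeVaryingQueue.residualWork_eq_sup (hm ω) (hrc ω) (hS0 ω) θ
  have hWm : Measurable fun ω =>
      TimeVaryingQueue.residualWork (fun t => N t ω) (fun k => S k ω) θ := by
    have := (h.measurable_sup_excess_Ico 0 θ).mono (h.measurable_futureData 0).comap_le le_rfl
    simp only [hN0, ← Finset.range_eq_Ico] at this
    simpa only [hW] using this.coe_nnreal_real
  have hWL : MemLp (fun ω =>
      TimeVaryingQueue.residualWork (fun t => N t ω) (fun k => S k ω) θ) 2 P := by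
    rw [memLp_two_iff_integrable_sq hWm.aestronglyMeasurable]
    refine (hG le_rfl).1.mono' (hWm.pow_const 2).aestronglyMeasurable
      (Filter.Eventually.of_forall fun ω => ?_)
    rw [Real.norm_of_nonneg (sq_nonneg _), hW]
    have := TimeVaryingQueue.sup_excess_sq_le (hm ω) (hrc ω) (hN0 ω) (hS0 ω) hγ hg0 d θ
    rwa [hgd] at this
  refine ⟨hWL, fun i hi => ?_⟩
  set t := g (d - i) with ht
  have htθ : t ≤ θ := hgd ▸ hgm (Nat.sub_le d i)
  have hpast := (h.measurable_pastData t).comap_le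
  have hfut := (h.measurable_futureData t).comap_le
  have hF : (⨆ j ∈ Finset.Ioc i d, MeasurableSpace.comap
      ((fun j => TimeVaryingQueue.drivingData N S θ d (d - j)) j) inferInstance)
      ≤ MeasurableSpace.comap (TimeVaryingQueue.pastData N S t) inferInstance := by
    refine iSup₂_le fun j hj => h.comap_drivingData_le θ t d (d - j) ?_
    rw [Finset.mem_Ioc] at hj
    have : g (d - j + 1) ≤ t := hgm (by omega)
    simpa [hg] using this
  -- the residual work at `θ` of the system emptied at `t`
  set V' : Ω → ℝ≥0 := fun ω => (Finset.Ico (N t ω) (N θ ω)).sup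
    (TimeVaryingQueue.excess (fun t => N t ω) (fun k => S k ω) θ) with hV'
  have hV'm := (h.measurable_sup_excess_Ico t θ).coe_nnreal_real
  have hmax : ∀ ω, TimeVaryingQueue.residualWork (fun t => N t ω) (fun k => S k ω) θ
      = max (((Finset.range (N t ω)).sup
          (TimeVaryingQueue.excess (fun t => N t ω) (fun k => S k ω) θ) : ℝ≥0) : ℝ) (V' ω) := by
    intro ω
    rw [hW, ← NNReal.coe_max, hV', ← Finset.sup_union, Finset.range_eq_Ico,
      Finset.range_eq_Ico, Finset.Ico_union_Ico_eq_Ico (Nat.zero_le _) (hm ω htθ)]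
  have hV'L : MemLp (fun ω => (V' ω : ℝ)) 2 P := by
    refine hWL.mono (hV'm.mono hfut le_rfl).aestronglyMeasurable
      (Filter.Eventually.of_forall fun ω => ?_)
    rw [Real.norm_of_nonneg (NNReal.coe_nonneg _), hmax]
    exact (le_max_right _ _).trans (Real.le_norm_self _)
  have hvar := TimeVaryingQueue.variance_condExp_le_integral (hF.trans hpast) hfut hWL hV'L
    (hG (Nat.sub_le d i)).1 hV'm.stronglyMeasurable
    (indep_of_indep_of_le_right ((IndepFun_iff_Indep _ _ _).1 (h.indepFun_past_future t)).symm hF)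
    (fun ω => by
      refine le_trans ?_ (TimeVaryingQueue.sup_excess_sq_le (hm ω) (hrc ω) (hN0 ω) (hS0 ω) hγ hg0
        (d - i) θ)
      rw [hmax]
      refine pow_le_pow_left₀ (sub_nonneg.2 (le_max_right _ _)) ?_ 2
      rw [sub_le_iff_le_add]
      exact max_le (le_add_of_nonneg_right (NNReal.coe_nonneg _))
        (le_add_of_nonneg_left (NNReal.coe_nonneg _)))
  rw [TimeVaryingQueue.queueC, TimeVaryingQueue.capturedVariance]
  refine hvar.trans ((hG (Nat.sub_le d i)).2.trans ?_)
  have hκ1 : 0 < 1 - κ := by linarith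
  refine mul_le_mul_of_nonneg_left ?_ (by positivity)
  rw [show d - (d - i) = i by omega, ← Real.rpow_natCast]
  refine Real.rpow_le_rpow_of_exponent_ge hκ0 hκ.le ?_
  have : (0 : ℝ) ≤ i := Nat.cast_nonneg i
  linarith
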